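/- Let $a<b$ be real numbers and let $L^1\,]a,b[$ be the set of Lebesgue integrable functions $f:\,]a,b[\,\to\mathbb{R}$. For $M\subset\,]a,b[$ of Lebesgue measure $0$, put $$T_{f_M}]a,b[\;=\;\sup\sum_{i=1}^n |f(x_i)-f(x_{i-1})|,$$ where the supremum is taken over all finite sequences $x_0<x_1<\cdots<x_n$ of points of $]a,b[\,\setminus M$. Let $BVC\,]a,b[$ (the functions of bounded variation in the sense of Cesari) be the set of all $f\in L^1\,]a,b[$ for which there is a set $M\subset\,]a,b[$ of Lebesgue measure $0$ with $T_{f_M}]a,b[\,<+\infty$. Let $BVL^1\,]a,b[$ be the set of all $f\in L^1\,]a,b[$ whose distributional derivative is represented by a finite signed Radon measure on $]a,b[$, i.e. for which there is a signed Radon measure $\mu$ on $]a,b[$ with $|\mu|(]a,b[)<+\infty$ and $$\int_{]a,b[} f\,\varphi'\,dx\;=\;-\int_{]a,b[}\varphi\,d\mu\qquad\text{for all }\varphi\in C_c^\infty\,]a,b[.$$ Then $$BVC\,]a,b[\;=\;BVL^1\,]a,b[.$$ -/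

import Mathlib

open MeasureTheory Set
open scoped ContDiff

/-- Lebesgue measure on the open interval `]a,b[`: the measure of `S ⊆ ]a,b[` is the Lebesgue
measure of `S` as a subset of `ℝ`. -/
noncomputable abbrev lebesgueIoo (a b : ℝ) : Measure (Ioo a b) :=
  Measure.comap ((↑) : Ioo a b → ℝ) volume

/-- A finite signed Radon measure: the positive and the negative variation (of the Jordan
decomposition `μ = μ⁺ - μ⁻`) are Radon measures, i.e. Borel measures that are finite on compact
sets, outer regular on Borel sets and inner regular on open sets, and `|μ| = μ⁺ + μ⁻` has finite
total mass. -/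
structure IsFiniteSignedRadon {X : Type*} [TopologicalSpace X] [MeasurableSpace X]
    (μ : SignedMeasure X) : Prop where
  regular_posPart : μ.toJordanDecomposition.posPart.Regular
  regular_negPart : μ.toJordanDecomposition.negPart.Regular
  totalVariation_lt_top : μ.totalVariation univ < ⊤

/-- The signed measure `μ` on the open interval `]a,b[` represents the distributional derivative
of `f : ]a,b[ → ℝ`: for every infinitely differentiable `φ` with compact support contained in
`]a,b[`, the integral of `f φ'` over `]a,b[` is minus the integral of `φ` against `μ`. -/
def IsDistribDeriv {a b : ℝ} (f : Ioo a b → ℝ) (μ : SignedMeasure (Ioo a b)) : Prop :=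
  ∀ φ : ℝ → ℝ, ContDiff ℝ ∞ φ → HasCompactSupport φ → tsupport φ ⊆ Ioo a b →
    ∫ x : Ioo a b, f x * deriv φ x ∂(lebesgueIoo a b) = -∫ᵛ x : Ioo a b, φ x ∂<•μ

/-- `BV L¹ ]a,b[`: the functions in `L¹ ]a,b[` (for Lebesgue measure) whose distributional
derivative is represented by a finite signed Radon measure on `]a,b[`. -/
def BVL1 (a b : ℝ) : Set (Ioo a b → ℝ) :=
  {f | Integrable f (lebesgueIoo a b) ∧
    ∃ μ : SignedMeasure (Ioo a b), IsFiniteSignedRadon μ ∧ IsDistribDeriv f μ}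

/-- `BVC ]a,b[`: the functions in `L¹ ]a,b[` that are of bounded variation in the sense of Cesari,
i.e. for some Lebesgue null set `M ⊆ ]a,b[` the sums `∑ |f (xᵢ) - f (xᵢ₋₁)|` over the finite
increasing sequences of points of `]a,b[ \ M` are bounded. Here `Mᶜ` is the complement of `M` in
`]a,b[`; repetitions of points do not change the supremum. -/
def BVC (a b : ℝ) : Set (Ioo a b → ℝ) :=
  {f | Integrable f (lebesgueIoo a b) ∧
    ∃ M : Set (Ioo a b), lebesgueIoo a b M = 0 ∧ eVariationOn f Mᶜ < ⊤}

section

variable {a b : ℝ}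

/-! Up to a null set and an additive constant, both classes consist of the differences `t ↦
ν₁(]a,t]) - ν₂(]a,t])` with `ν₁`, `ν₂` finite measures. Fubini shows that such a difference has
distributional derivative `ν₁ - ν₂` (`isDistribDeriv_measureReal_sub`). If `f` has bounded variation
off a null set, it is there a difference of monotone functions on `ℝ`, and each of these is a.e. a
Stieltjes distribution function plus a constant (`Monotone.exists_measure_Ioo`). Conversely, the
Jordan decomposition of `μ` gives a difference `g` with the same derivative as `f`. By du
Bois-Reymond `f - g` is a.e. constant, and `g` has bounded variation. -/

lemma integral_lebesgueIoo (g : ℝ → ℝ) :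
    ∫ x : Ioo a b, g x ∂(lebesgueIoo a b) = ∫ x in Ioo a b, g x :=
  integral_subtype_comap measurableSet_Ioo g

lemma ae_lebesgueIoo_iff {p : ℝ → Prop} :
    (∀ᵐ x : Ioo a b ∂(lebesgueIoo a b), p x) ↔ ∀ᵐ x : ℝ, x ∈ Ioo a b → p x := by
  rw [← ae_restrict_iff' measurableSet_Ioo, ae_restrict_iff_subtype measurableSet_Ioo]

instance isFiniteMeasure_lebesgueIoo : IsFiniteMeasure (lebesgueIoo a b) := by
  constructor
  rw [(MeasurableEmbedding.subtype_coe measurableSet_Ioo).comap_apply, image_univ,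
    Subtype.range_coe]
  exact measure_Ioo_lt_top

lemma integrable_lebesgueIoo_iff {g : ℝ → ℝ} :
    Integrable (fun x : Ioo a b ↦ g x) (lebesgueIoo a b) ↔ IntegrableOn g (Ioo a b) := by
  rw [IntegrableOn, ← map_comap_subtype_coe measurableSet_Ioo,
    (MeasurableEmbedding.subtype_coe measurableSet_Ioo).integrable_map_iff]
  rfl

lemma regular_of_isFiniteMeasure_Ioo (ν : Measure (Ioo a b)) [IsFiniteMeasure ν] :
    ν.Regular := by
  have : LocallyCompactSpace (Ioo a b) := isOpen_Ioo.locallyCompactSpace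
  infer_instance

/-- Finite Borel measures on `]a,b[` are automatically regular, so the Radon condition is free. -/
lemma isFiniteSignedRadon_Ioo (μ : SignedMeasure (Ioo a b)) : IsFiniteSignedRadon μ where
  regular_posPart := regular_of_isFiniteMeasure_Ioo _
  regular_negPart := regular_of_isFiniteMeasure_Ioo _
  totalVariation_lt_top := measure_lt_top _ _

lemma eq_zero_of_tsupport_subset {φ : ℝ → ℝ} {s : Set ℝ} (h : tsupport φ ⊆ s) {x : ℝ}
    (hx : x ∉ s) : φ x = 0 :=
  image_eq_zero_of_notMem_tsupport fun hx' ↦ hx (h hx')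

lemma setIntegral_Ioo_deriv_eq_zero {φ : ℝ → ℝ} (hφ : ContDiff ℝ ∞ φ)
    (hs : tsupport φ ⊆ Ioo a b) : ∫ x in Ioo a b, deriv φ x = 0 := by
  rcases le_or_gt b a with h | h
  · simp [h]
  rw [← integral_Ioc_eq_integral_Ioo, ← intervalIntegral.integral_of_le h.le,
    intervalIntegral.integral_deriv_eq_sub
      (fun x _ ↦ (hφ.differentiable (by simp)).differentiableAt)
      ((hφ.continuous_deriv (by simp)).intervalIntegrable _ _),
    eq_zero_of_tsupport_subset hs (by simp), eq_zero_of_tsupport_subset hs (by simp), sub_zero]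

/-! ### Distribution functions of finite measures and their derivatives -/

lemma integral_indicator_Ici_deriv {φ : ℝ → ℝ} (hφ : ContDiff ℝ ∞ φ)
    (hs : tsupport φ ⊆ Ioo a b) (x : Ioo a b) :
    ∫ t : Ioo a b, (Ici x).indicator (fun t ↦ deriv φ t) t ∂(lebesgueIoo a b) = -φ x := by
  have h1 : ∀ t : Ioo a b, (Ici x).indicator (fun t : Ioo a b ↦ deriv φ t) t
      = (Ici (x : ℝ)).indicator (deriv φ) t := fun t ↦ by
    simp [indicator, ← Subtype.coe_le_coe]
  simp_rw [h1]
  rw [integral_lebesgueIoo, setIntegral_indicator measurableSet_Ici]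
  have h2 : Ioo a b ∩ Ici (x : ℝ) = Ico (x : ℝ) b := by
    ext t
    have := x.2.1
    simp only [mem_inter_iff, mem_Ioo, mem_Ici, mem_Ico]
    grind
  rw [h2, integral_Ico_eq_integral_Ioo, ← integral_Ioc_eq_integral_Ioo,
    ← intervalIntegral.integral_of_le x.2.2.le,
    intervalIntegral.integral_deriv_eq_sub
      (fun x _ ↦ (hφ.differentiable (by simp)).differentiableAt)
      ((hφ.continuous_deriv (by simp)).intervalIntegrable _ _),
    eq_zero_of_tsupport_subset hs (by simp), zero_sub]

lemma HasCompactSupport.integrable_restrict_Ioo {φ : ℝ → ℝ} (hc : HasCompactSupport φ)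
    (hφ : Continuous φ) (ν : Measure (Ioo a b)) [IsFiniteMeasure ν] :
    Integrable (fun x : Ioo a b ↦ φ x) ν := by
  obtain ⟨C, hC⟩ := hφ.bounded_above_of_compact_support hc
  exact Integrable.of_bound (hφ.comp continuous_subtype_val).aestronglyMeasurable C
    (ae_of_all _ fun x ↦ hC x)

/-- Integration by parts against the distribution function of a finite measure. -/
lemma integral_measureReal_Iic_mul_deriv (ν : Measure (Ioo a b)) [IsFiniteMeasure ν]
    {φ : ℝ → ℝ} (hφ : ContDiff ℝ ∞ φ) (hc : HasCompactSupport φ) (hs : tsupport φ ⊆ Ioo a b) :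
    ∫ t : Ioo a b, ν.real (Iic t) * deriv φ t ∂(lebesgueIoo a b) = -∫ x, φ x ∂ν := by
  have hd : Continuous (deriv φ) := hφ.continuous_deriv (by simp)
  obtain ⟨C, hC⟩ := hd.bounded_above_of_compact_support hc.deriv
  have hint : Integrable (Function.uncurry fun (x t : Ioo a b) ↦
      (Ici x).indicator (fun t : Ioo a b ↦ deriv φ t) t) (ν.prod (lebesgueIoo a b)) := by
    have : (Function.uncurry fun (x t : Ioo a b) ↦
        (Ici x).indicator (fun t : Ioo a b ↦ deriv φ t) t)
        = {p : Ioo a b × Ioo a b | p.1 ≤ p.2}.indicator fun p ↦ deriv φ p.2 := by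
      ext ⟨x, t⟩
      simp [indicator]
    rw [this]
    refine Integrable.indicator ?_ (measurableSet_le measurable_fst measurable_snd)
    exact Integrable.of_bound (by fun_prop) C (ae_of_all _ fun x ↦ hC _)
  -- Fubini for `1_{x ≤ t} φ'(t)`: integrating in `t` first gives `-φ x`, in `x` first gives `ν(Iic
  -- t) φ'(t)`.
  have h := integral_integral_swap hint
  simp_rw [integral_indicator_Ici_deriv hφ hs] at h
  rw [integral_neg] at h
  rw [h]
  refine integral_congr_ae (ae_of_all _ fun t ↦ ?_)
  have : (fun x : Ioo a b ↦ (Ici x).indicator (fun t : Ioo a b ↦ deriv φ t) t)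
      = (Iic t).indicator fun _ ↦ deriv φ t := by
    ext x
    simp [indicator]
  simp only [this]
  rw [integral_indicator_const _ measurableSet_Iic, smul_eq_mul]

lemma monotone_measureReal_Iic (ν : Measure (Ioo a b)) [IsFiniteMeasure ν] :
    Monotone fun t ↦ ν.real (Iic t) :=
  fun _ _ h ↦ measureReal_mono (Iic_subset_Iic.2 h)

lemma integrable_measureReal_Iic (ν : Measure (Ioo a b)) [IsFiniteMeasure ν] :
    Integrable (fun t ↦ ν.real (Iic t)) (lebesgueIoo a b) :=
  Integrable.of_bound (monotone_measureReal_Iic ν).measurable.aestronglyMeasurable (ν.real univ)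
    (ae_of_all _ fun t ↦ by
      rw [Real.norm_of_nonneg measureReal_nonneg]
      exact measureReal_mono (subset_univ _))

lemma integral_toSignedMeasure_sub (ν₁ ν₂ : Measure (Ioo a b)) [IsFiniteMeasure ν₁]
    [IsFiniteMeasure ν₂] {φ : ℝ → ℝ} (hφ : Continuous φ) (hc : HasCompactSupport φ) :
    ∫ᵛ x : Ioo a b, φ x ∂<•(ν₁.toSignedMeasure - ν₂.toSignedMeasure) =
      ∫ x : Ioo a b, φ x ∂ν₁ - ∫ x : Ioo a b, φ x ∂ν₂ := by
  rw [VectorMeasure.integral_sub_vectorMeasure, VectorMeasure.integral_toSignedMeasure,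
    VectorMeasure.integral_toSignedMeasure]
  · simpa [VectorMeasure.Integrable] using hc.integrable_restrict_Ioo hφ ν₁
  · simpa [VectorMeasure.Integrable] using hc.integrable_restrict_Ioo hφ ν₂

lemma Integrable.mul_deriv_Ioo {g : Ioo a b → ℝ} (hg : Integrable g (lebesgueIoo a b))
    {φ : ℝ → ℝ} (hφ : ContDiff ℝ ∞ φ) (hc : HasCompactSupport φ) :
    Integrable (fun x : Ioo a b ↦ g x * deriv φ x) (lebesgueIoo a b) := by
  have hd : Continuous (deriv φ) := hφ.continuous_deriv (by simp)
  obtain ⟨C, hC⟩ := hd.bounded_above_of_compact_support hc.deriv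
  exact hg.mul_bdd (hd.comp continuous_subtype_val).aestronglyMeasurable
    (ae_of_all _ fun x ↦ hC _)

lemma isDistribDeriv_measureReal_sub (ν₁ ν₂ : Measure (Ioo a b)) [IsFiniteMeasure ν₁]
    [IsFiniteMeasure ν₂] :
    IsDistribDeriv (fun t ↦ ν₁.real (Iic t) - ν₂.real (Iic t))
      (ν₁.toSignedMeasure - ν₂.toSignedMeasure) := by
  intro φ hφ hc hs
  simp_rw [sub_mul]
  rw [integral_sub (Integrable.mul_deriv_Ioo (integrable_measureReal_Iic ν₁) hφ hc)
    (Integrable.mul_deriv_Ioo (integrable_measureReal_Iic ν₂) hφ hc),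
    integral_measureReal_Iic_mul_deriv ν₁ hφ hc hs, integral_measureReal_Iic_mul_deriv ν₂ hφ hc hs,
    integral_toSignedMeasure_sub ν₁ ν₂ hφ.continuous hc]
  ring

lemma IsDistribDeriv.congr_ae_add_const {f g : Ioo a b → ℝ} {μ : SignedMeasure (Ioo a b)}
    (hg : IsDistribDeriv g μ) (hgi : Integrable g (lebesgueIoo a b)) {c : ℝ}
    (h : ∀ᵐ x ∂(lebesgueIoo a b), f x = g x + c) : IsDistribDeriv f μ := by
  intro φ hφ hc hs
  rw [← hg φ hφ hc hs]
  have h1 : ∫ x : Ioo a b, f x * deriv φ x ∂(lebesgueIoo a b) =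
      ∫ x : Ioo a b, (g x * deriv φ x + c * deriv φ x) ∂(lebesgueIoo a b) := by
    refine integral_congr_ae ?_
    filter_upwards [h] with x hx
    rw [hx, add_mul]
  rw [h1, integral_add (Integrable.mul_deriv_Ioo hgi hφ hc)
    (Integrable.mul_deriv_Ioo (integrable_const c) hφ hc), integral_const_mul,
    integral_lebesgueIoo (deriv φ), setIntegral_Ioo_deriv_eq_zero hφ hs, mul_zero, add_zero]

lemma Monotone.exists_measure_Ioo {P : ℝ → ℝ} (hP : Monotone P) :
    ∃ ν : Measure (Ioo a b), IsFiniteMeasure ν ∧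
      ∃ c, ∀ᵐ t : Ioo a b ∂(lebesgueIoo a b), P t = ν.real (Iic t) + c := by
  have he := MeasurableEmbedding.subtype_coe (measurableSet_Ioo (a := a) (b := b))
  -- The Stieltjes mass of `]a,t]` is `P(t+) - P(a+)`, hence the constant `P(a+)`; at the continuity
  -- points, which are almost all points, `P(t+) = P t`.
  refine ⟨hP.stieltjesFunction.measure.comap (↑), ⟨?_⟩, Function.rightLim P a, ?_⟩
  · rw [he.comap_apply, image_univ, Subtype.range_coe, StieltjesFunction.measure_Ioo]
    exact ENNReal.ofReal_lt_top
  · have h : ∀ᵐ t : Ioo a b ∂(lebesgueIoo a b), ContinuousAt P t := by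
      refine ae_lebesgueIoo_iff.2 ?_
      filter_upwards [hP.countable_not_continuousAt.ae_notMem volume] with x hx _
      simpa using hx
    filter_upwards [h] with t ht
    have himg : ((↑) : Ioo a b → ℝ) '' Iic t = Ioc a t := by
      ext x
      simp only [mem_image, mem_Iic, mem_Ioc]
      exact ⟨fun ⟨y, hy, hyx⟩ ↦ hyx ▸ ⟨y.2.1, hy⟩,
        fun hx ↦ ⟨⟨x, hx.1, hx.2.trans_lt t.2.2⟩, hx.2, rfl⟩⟩
    have hr : Function.rightLim P t = P t :=
      hP.continuousWithinAt_Ioi_iff_rightLim_eq.1 ht.continuousWithinAt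
    rw [measureReal_def, he.comap_apply, himg, StieltjesFunction.measure_Ioc,
      ENNReal.toReal_ofReal (sub_nonneg.2 (hP.stieltjesFunction.mono t.2.1.le)),
      hP.stieltjesFunction_eq, hP.stieltjesFunction_eq, hr]
    ring

/-! ### The du Bois-Reymond lemma -/

/-- A primitive of a test function of zero integral is a test function. -/
lemma exists_testFunction_deriv_eq (hab : a < b) {θ : ℝ → ℝ} (hθ : ContDiff ℝ ∞ θ)
    (hc : HasCompactSupport θ) (hs : tsupport θ ⊆ Ioo a b) (h0 : ∫ x in Ioo a b, θ x = 0) :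
    ∃ φ : ℝ → ℝ, ContDiff ℝ ∞ φ ∧ HasCompactSupport φ ∧ tsupport φ ⊆ Ioo a b ∧ deriv φ = θ := by
  obtain ⟨c, d, hac, hdb, hcd⟩ : ∃ c d, a < c ∧ d < b ∧ tsupport θ ⊆ Icc c d := by
    rcases (tsupport θ).eq_empty_or_nonempty with h | h
    · exact ⟨a + 1, b - 1, by simp, by simp, by simp [h]⟩
    · exact ⟨sInf (tsupport θ), sSup (tsupport θ), (hs (hc.isCompact.sInf_mem h)).1,
        (hs (hc.isCompact.sSup_mem h)).2,
        fun x hx ↦ ⟨csInf_le hc.isCompact.bddBelow hx, le_csSup hc.isCompact.bddAbove hx⟩⟩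
  have hd : ∀ x, HasDerivAt (fun x ↦ ∫ t in a..x, θ t) (θ x) x := fun x ↦
    intervalIntegral.integral_hasDerivAt_right (hθ.continuous.intervalIntegrable _ _)
      (hθ.continuous.stronglyMeasurableAtFilter _ _) hθ.continuous.continuousAt
  have hd' : deriv (fun x ↦ ∫ t in a..x, θ t) = θ := funext fun x ↦ (hd x).deriv
  have hsupp : Function.support (fun x ↦ ∫ t in a..x, θ t) ⊆ Icc c d := by
    refine Function.support_subset_iff'.2 fun x hx ↦ ?_
    rw [mem_Icc, not_and_or, not_le, not_le] at hx
    rcases hx with hx | hx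
    · rw [intervalIntegral.integral_congr (g := fun _ ↦ 0), intervalIntegral.integral_zero]
      intro t ht
      refine eq_zero_of_tsupport_subset hcd fun h ↦ ?_
      exact (ht.2.trans_lt (sup_lt_iff.2 ⟨hac, hx⟩)).not_ge h.1
    -- Right of `d` the primitive vanishes only because `θ` has integral zero.
    · rw [← intervalIntegral.integral_add_adjacent_intervals
        (hθ.continuous.intervalIntegrable a b) (hθ.continuous.intervalIntegrable b x),
        intervalIntegral.integral_of_le hab.le, integral_Ioc_eq_integral_Ioo, h0, zero_add,
        intervalIntegral.integral_congr (g := fun _ ↦ 0), intervalIntegral.integral_zero]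
      intro t ht
      refine eq_zero_of_tsupport_subset hcd fun h ↦ ?_
      exact ((lt_inf_iff.2 ⟨hdb, hx⟩).trans_le ht.1).not_ge h.2
  have htsupp := closure_minimal hsupp isClosed_Icc
  refine ⟨_, ?_, HasCompactSupport.of_support_subset_isCompact isCompact_Icc hsupp,
    htsupp.trans (Icc_subset_Ioo hac hdb), hd'⟩
  rw [contDiff_infty_iff_deriv, hd']
  exact ⟨fun x ↦ (hd x).differentiableAt, hθ⟩

lemma exists_testFunction_integral_eq_one (hab : a < b) :
    ∃ ψ : ℝ → ℝ, ContDiff ℝ ∞ ψ ∧ HasCompactSupport ψ ∧ tsupport ψ ⊆ Ioo a b ∧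
      ∫ x in Ioo a b, ψ x = 1 := by
  let B : ContDiffBump ((a + b) / 2) := ⟨(b - a) / 8, (b - a) / 4, by linarith, by linarith⟩
  have hs : tsupport (B.normed volume) ⊆ Ioo a b := by
    rw [B.tsupport_normed_eq, Real.closedBall_eq_Icc]
    exact Icc_subset_Ioo (by simp only [B]; linarith) (by simp only [B]; linarith)
  refine ⟨B.normed volume, B.contDiff_normed, B.hasCompactSupport_normed, hs, ?_⟩
  rw [setIntegral_eq_integral_of_forall_compl_eq_zero fun x hx ↦ eq_zero_of_tsupport_subset hs hx,
    B.integral_normed]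

/-- The **du Bois-Reymond lemma** on a bounded open interval. -/
lemma ae_eq_const_of_integral_mul_deriv_eq_zero (hab : a < b) {h : Ioo a b → ℝ}
    (hi : Integrable h (lebesgueIoo a b))
    (H : ∀ φ : ℝ → ℝ, ContDiff ℝ ∞ φ → HasCompactSupport φ → tsupport φ ⊆ Ioo a b →
      ∫ x : Ioo a b, h x * deriv φ x ∂(lebesgueIoo a b) = 0) :
    ∃ c, ∀ᵐ x ∂(lebesgueIoo a b), h x = c := by
  obtain ⟨ψ, hψ, hψc, hψs, hψ1⟩ := exists_testFunction_integral_eq_one hab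
  have hmul : ∀ g : Ioo a b → ℝ, Integrable g (lebesgueIoo a b) → ∀ {η : ℝ → ℝ}, Continuous η →
      HasCompactSupport η → Integrable (fun x : Ioo a b ↦ g x * η x) (lebesgueIoo a b) := by
    intro g hg η hη hηc
    obtain ⟨C, hC⟩ := hη.bounded_above_of_compact_support hηc
    exact hg.mul_bdd (hη.comp continuous_subtype_val).aestronglyMeasurable
      (ae_of_all _ fun x ↦ hC _)
  set c := ∫ x : Ioo a b, h x * ψ x ∂(lebesgueIoo a b) with hc
  refine ⟨c, ?_⟩
  let k : ℝ → ℝ := Function.extend ((↑) : Ioo a b → ℝ) h 0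
  have hk : ∀ x : Ioo a b, k x = h x := Subtype.val_injective.extend_apply h 0
  have hki : IntegrableOn (fun x ↦ k x - c) (Ioo a b) := by
    rw [← integrable_lebesgueIoo_iff]
    simp_rw [hk]
    exact hi.sub (integrable_const c)
  have key := isOpen_Ioo.ae_eq_zero_of_integral_contDiff_smul_eq_zero
    hki.locallyIntegrableOn ?_
  · filter_upwards [(ae_lebesgueIoo_iff (p := fun x ↦ k x - c = 0)).2 key] with x hx
    rw [hk] at hx
    linarith
  intro η hη hηc hηs
  set m := ∫ x in Ioo a b, η x with hm
  have hηi : ∀ {η : ℝ → ℝ}, Continuous η → HasCompactSupport η → IntegrableOn η (Ioo a b) :=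
    fun h1 h2 ↦ (h1.integrable_of_hasCompactSupport h2).integrableOn
  -- `η - m • ψ` has integral zero, so it is some `φ'`; then `H` gives `∫ h η = m c = ∫ c η`.
  have hθs : tsupport (η - m • ψ) ⊆ Ioo a b :=
    (tsupport_sub _ _).trans (union_subset hηs ((tsupport_smul_subset_right (fun _ ↦ m) ψ).trans hψs))
  have hθc : HasCompactSupport (η - m • ψ) := hηc.sub (hψc.smul_left (f := fun _ ↦ m))
  obtain ⟨φ, hφ, hφc, hφs, hφd⟩ := exists_testFunction_deriv_eq hab (hη.sub (hψ.const_smul m)) hθc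
    hθs (by
      simp only [smul_eq_mul]
      rw [integral_sub (hηi hη.continuous hηc) ((hηi hψ.continuous hψc).const_mul m),
        integral_const_mul, hψ1, mul_one, sub_self])
  have h1 := H φ hφ hφc hφs
  simp only [hφd, smul_eq_mul, mul_sub, mul_left_comm _ m] at h1
  rw [integral_sub (hmul h hi hη.continuous hηc) ((hmul h hi hψ.continuous hψc).const_mul m),
    integral_const_mul, ← hc] at h1
  rw [← setIntegral_eq_integral_of_forall_compl_eq_zero (s := Ioo a b) fun x hx ↦ by
    rw [eq_zero_of_tsupport_subset hηs hx, zero_smul],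
    ← integral_lebesgueIoo (fun x ↦ η x • (k x - c))]
  simp only [hk, smul_eq_mul, mul_sub]
  simp only [mul_comm (η _)]
  rw [integral_sub (hmul h hi hη.continuous hηc)
    (hmul _ (integrable_const c) hη.continuous hηc), integral_const_mul, integral_lebesgueIoo η,
    ← hm]
  linarith

/-! ### Bounded variation and the two inclusions -/

lemma BoundedVariationOn.bddBelow_bddAbove_image {α : Type*} [LinearOrder α] {f : α → ℝ}
    {s : Set α} (hf : BoundedVariationOn f s) : BddBelow (f '' s) ∧ BddAbove (f '' s) := by
  rcases s.eq_empty_or_nonempty with rfl | ⟨x, hx⟩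
  · simp
  refine ⟨⟨f x - (eVariationOn f s).toReal, ?_⟩, ⟨f x + (eVariationOn f s).toReal, ?_⟩⟩
  · rintro _ ⟨y, hy, rfl⟩
    linarith [hf.sub_le hx hy]
  · rintro _ ⟨y, hy, rfl⟩
    linarith [hf.sub_le hy hx]

/-- A real function of bounded variation on a set coincides there with a difference of monotone
functions defined everywhere. -/
lemma BoundedVariationOn.exists_monotone_sub_monotone {α : Type*} [LinearOrder α] {f : α → ℝ}
    {s : Set α} (hf : BoundedVariationOn f s) :
    ∃ P Q : α → ℝ, Monotone P ∧ Monotone Q ∧ EqOn f (P - Q) s := by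
  rcases s.eq_empty_or_nonempty with rfl | ⟨x₀, hx₀⟩
  · exact ⟨0, 0, monotone_const, monotone_const, eqOn_empty _ _⟩
  set p := variationOnFromTo f s x₀
  have hp : MonotoneOn p s := variationOnFromTo.monotoneOn hf.locallyBoundedVariationOn hx₀
  have hq : MonotoneOn (p - f) s :=
    variationOnFromTo.sub_self_monotoneOn hf.locallyBoundedVariationOn hx₀
  have hpb : ∀ x, |p x| ≤ (eVariationOn f s).toReal := fun x ↦
    variationOnFromTo.abs_le_eVariationOn hf
  -- Extending a monotone function from `s` to all of `α` uses bounds on its image.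
  obtain ⟨⟨l, hl⟩, ⟨u, hu⟩⟩ := hf.bddBelow_bddAbove_image
  obtain ⟨P, hP, hpP⟩ := hp.exists_monotone_extension
    ⟨-(eVariationOn f s).toReal, by rintro _ ⟨y, -, rfl⟩; exact (abs_le.1 (hpb y)).1⟩
    ⟨(eVariationOn f s).toReal, by rintro _ ⟨y, -, rfl⟩; exact (abs_le.1 (hpb y)).2⟩
  obtain ⟨Q, hQ, hqQ⟩ := hq.exists_monotone_extension
    ⟨-(eVariationOn f s).toReal - u, by
      rintro _ ⟨y, hy, rfl⟩
      exact sub_le_sub (abs_le.1 (hpb y)).1 (hu (mem_image_of_mem f hy))⟩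
    ⟨(eVariationOn f s).toReal - l, by
      rintro _ ⟨y, hy, rfl⟩
      exact sub_le_sub (abs_le.1 (hpb y)).2 (hl (mem_image_of_mem f hy))⟩
  refine ⟨P, Q, hP, hQ, fun x hx ↦ ?_⟩
  rw [Pi.sub_apply, ← hpP hx, ← hqQ hx, Pi.sub_apply, sub_sub_cancel]

lemma BVC_subset_BVL1 : BVC a b ⊆ BVL1 a b := by
  rintro f ⟨hfi, M, hM, hf⟩
  refine ⟨hfi, ?_⟩
  -- Moving to `ℝ`, where Stieltjes measures live, keeps the variation; the value 0 outside `]a,b[`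
  -- plays no role.
  have hf' : BoundedVariationOn (Function.extend ((↑) : Ioo a b → ℝ) f 0) ((↑) '' Mᶜ) := by
    have h := eVariationOn.comp_eq_of_monotoneOn (Function.extend ((↑) : Ioo a b → ℝ) f 0)
      (t := Mᶜ) ((↑) : Ioo a b → ℝ) ((Subtype.mono_coe _).monotoneOn _)
    rw [Function.extend_comp Subtype.val_injective] at h
    rw [BoundedVariationOn, ← h]
    exact hf.ne
  obtain ⟨P, Q, hP, hQ, hPQ⟩ := hf'.exists_monotone_sub_monotone
  obtain ⟨ν₁, _, c₁, h₁⟩ := hP.exists_measure_Ioo (a := a) (b := b)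
  obtain ⟨ν₂, _, c₂, h₂⟩ := hQ.exists_measure_Ioo (a := a) (b := b)
  refine ⟨ν₁.toSignedMeasure - ν₂.toSignedMeasure, isFiniteSignedRadon_Ioo _,
    (isDistribDeriv_measureReal_sub ν₁ ν₂).congr_ae_add_const
      ((integrable_measureReal_Iic ν₁).sub (integrable_measureReal_Iic ν₂)) (c := c₁ - c₂) ?_⟩
  filter_upwards [h₁, h₂, compl_mem_ae_iff.2 hM] with x hx₁ hx₂ hxM
  have h := hPQ (mem_image_of_mem _ hxM)
  rw [Subtype.val_injective.extend_apply, Pi.sub_apply] at h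
  rw [h, hx₁, hx₂]
  ring

lemma eVariationOn_sub_le {α : Type*} [LinearOrder α] (p q : α → ℝ) (s : Set α) :
    eVariationOn (p - q) s ≤ eVariationOn p s + eVariationOn q s := by
  refine iSup_le fun u ↦ ?_
  refine le_trans ?_ (add_le_add (eVariationOn.sum_le (n := u.1) u.2.2.1 u.2.2.2)
    (eVariationOn.sum_le (n := u.1) u.2.2.1 u.2.2.2))
  rw [← Finset.sum_add_distrib]
  refine Finset.sum_le_sum fun i _ ↦ ?_
  simp only [Pi.sub_apply, sub_eq_add_neg]
  refine (edist_add_add_le _ _ _ _).trans_eq ?_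
  rw [edist_neg_neg]

lemma boundedVariationOn_measureReal_sub (ν₁ ν₂ : Measure (Ioo a b)) [IsFiniteMeasure ν₁]
    [IsFiniteMeasure ν₂] (s : Set (Ioo a b)) :
    BoundedVariationOn (fun t ↦ ν₁.real (Iic t) - ν₂.real (Iic t)) s := by
  have h : ∀ (ν : Measure (Ioo a b)) [IsFiniteMeasure ν],
      BoundedVariationOn (fun t ↦ ν.real (Iic t)) s := fun ν _ ↦
    ((monotone_measureReal_Iic ν).monotoneOn s).boundedVariationOn (C := ν.real univ)
      fun x _ ↦ by
        rw [abs_of_nonneg measureReal_nonneg]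
        exact measureReal_mono (subset_univ _)
  exact ((eVariationOn_sub_le _ _ s).trans_lt
    (ENNReal.add_lt_top.2 ⟨(h ν₁).lt_top, (h ν₂).lt_top⟩)).ne

lemma BVL1_subset_BVC (hab : a < b) : BVL1 a b ⊆ BVC a b := by
  rintro f ⟨hfi, μ, -, hμ⟩
  refine ⟨hfi, ?_⟩
  set ν₁ := μ.toJordanDecomposition.posPart
  set ν₂ := μ.toJordanDecomposition.negPart
  set g : Ioo a b → ℝ := fun t ↦ ν₁.real (Iic t) - ν₂.real (Iic t) with hg
  have hμ' : ν₁.toSignedMeasure - ν₂.toSignedMeasure = μ :=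
    μ.toSignedMeasure_toJordanDecomposition
  have hgi : Integrable g (lebesgueIoo a b) :=
    (integrable_measureReal_Iic ν₁).sub (integrable_measureReal_Iic ν₂)
  have hgμ : IsDistribDeriv g μ := hμ' ▸ isDistribDeriv_measureReal_sub ν₁ ν₂
  obtain ⟨c, hc⟩ := ae_eq_const_of_integral_mul_deriv_eq_zero hab (hfi.sub hgi)
      fun φ hφ hφc hφs ↦ by
    simp only [Pi.sub_apply, sub_mul]
    rw [integral_sub (Integrable.mul_deriv_Ioo hfi hφ hφc) (Integrable.mul_deriv_Ioo hgi hφ hφc),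
      hμ φ hφ hφc hφs, hgμ φ hφ hφc hφs, sub_self]
  -- Off this null set `f` is exactly `g + c`.
  refine ⟨{x | (f - g) x = c}ᶜ, hc, ?_⟩
  have hfg : EqOn f (g - fun _ ↦ -c) {x | (f - g) x = c} := fun x hx ↦ by
    have : f x - g x = c := hx
    simp only [Pi.sub_apply]
    linarith
  rw [compl_compl, eVariationOn.congr hfg]
  refine (eVariationOn_sub_le _ _ _).trans_lt (ENNReal.add_lt_top.2
    ⟨(boundedVariationOn_measureReal_sub ν₁ ν₂ _).lt_top, ?_⟩)
  rw [eVariationOn.constant_on (by rintro _ ⟨_, _, rfl⟩ _ ⟨_, _, rfl⟩; rfl)]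
  exact ENNReal.zero_lt_top

end

theorem mainTheorem6 (a b : ℝ) (hab : a < b) : BVC a b = BVL1 a b := by
  exact BVC_subset_BVL1.antisymm (BVL1_subset_BVC hab)
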